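/- For $\alpha\in(0,1)$ let $\sigma_\alpha:\mathbb{R}\to\mathbb{R}$ be the leaky ReLU $\sigma_\alpha(x)=\alpha x$ for $x<0$ and $\sigma_\alpha(x)=x$ for $x\ge 0$, and let $\mathcal{F}=\{\sigma_\alpha : \alpha\in(0,1)\}$ be the set of true leaky ReLUs. A feed-forward network $\phi:\mathbb{R}^{d_0}\to\mathbb{R}^{d_n}$ with activations in $\mathcal{F}$ is a composition $\phi=\varphi_n\circ W_n\circ\dots\circ\varphi_1\circ W_1$ with $n\ge 1$, where $W_i:\mathbb{R}^{d_{i-1}}\to\mathbb{R}^{d_i}$ is affine, $d_i\ge 1$, and $\varphi_i$ applies to each coordinate of $\mathbb{R}^{d_i}$ an element of $\mathcal{F}$ (possibly different ones for different coordinates). Its width is $\max_{1\le i\le n-1} d_i$ and its minimal interior dimension is $\min_{1\le i\le n-1} d_i$ (if $n=1$, these are $\max\{d_0,d_1\}$ and $\min\{d_0,d_1\}$). For $d\ge 2$ and $1\le k\le d$ let $\mathrm{AEN}^{(k)}_{\mathcal{F}}(d)$, the set of autoencoders of dimension $d$ with feature dimension $k$, be the set of functions $\mathbb{R}^d\to\mathbb{R}^d$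 given by such networks of width $d$ and minimal interior dimension $k$. For $p\in[1,\infty)$, a set $\mathcal{M}$ of measurable functions $\mathbb{R}^d\to\mathbb{R}^d$ that are $L^p$ on every compact set is called an $L^p$ universal approximator of $L^p(\mathbb{R}^d,\mathbb{R}^d)$ if for every $g\in L^p(\mathbb{R}^d,\mathbb{R}^d)$, every compact $K\subset\mathbb{R}^d$ and every $\varepsilon>0$ there is $f\in\mathcal{M}$ with $$\Big(\int_K \|f(x)-g(x)\|_p^p\,dx\Big)^{1/p}<\varepsilon,\qquad \|v\|_p=\Big(\sum_{i=1}^d|v_i|^p\Big)^{1/p}.$$ **Corollary.** Let $d\ge 2$ and $p\in[1,\infty)$. Then $\mathrm{AEN}^{(1)}_{\mathcal{F}}(d)$ is an $L^p$ universal approximator of $L^p(\mathbb{R}^d,\mathbb{R}^d)$. Moreover, for every feature dimension $d_{\min}\in\mathbb{N}$ with $1\le d_{\min}<d$, the set $\mathrm{AEN}^{(d_{\min})}_{\mathcal{F}}(d)$ is an $L^p$ universal approximator of $L^p(\mathbb{R}^d,\mathbb{R}^d)$. -/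

import Mathlib

open MeasureTheory
open scoped ENNReal

namespace LeakyNet

/-- The leaky rectified linear unit with slope `α` on the negative half-line. -/
noncomputable def leakyReLU (α : ℝ) : ℝ → ℝ :=
  fun x => if x < 0 then α * x else x

/-- The set of (invertible) true leaky ReLUs. -/
def trueLeakyReLUs : Set (ℝ → ℝ) :=
  {σ | ∃ α : ℝ, 0 < α ∧ α < 1 ∧ σ = leakyReLU α}

/-- One layer: the affine map `x ↦ A x + b` from `ℝ^m` to `ℝ^n`, followed by the activation
`σ i` in the `i`-th coordinate (the activations of different neurons may differ). -/
def layer {m n : ℕ} (A : Matrix (Fin n) (Fin m) ℝ) (b : Fin n → ℝ) (σ : Fin n → ℝ → ℝ) :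
    (Fin m → ℝ) → (Fin n → ℝ) :=
  fun x i => σ i ((A.mulVec x + b) i)

/-- `IsNetwork 𝒜 dx hidden dy φ` says that `φ : ℝ^dx → ℝ^dy` is represented by a feed-forward
neural network with activations in `𝒜` whose hidden layers have, in order from the input to the
output, the dimensions in the list `hidden`. The depth is `hidden.length + 1`. -/
inductive IsNetwork (𝒜 : Set (ℝ → ℝ)) :
    (dx : ℕ) → (hidden : List ℕ) → (dy : ℕ) → ((Fin dx → ℝ) → (Fin dy → ℝ)) → Prop
  | single {dx dy : ℕ} (A : Matrix (Fin dy) (Fin dx) ℝ) (b : Fin dy → ℝ)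
      (σ : Fin dy → ℝ → ℝ) (hσ : ∀ i, σ i ∈ 𝒜) :
      IsNetwork 𝒜 dx [] dy (layer A b σ)
  | cons {dx m dy : ℕ} {hidden : List ℕ} (hm : 0 < m) (A : Matrix (Fin m) (Fin dx) ℝ)
      (b : Fin m → ℝ) (σ : Fin m → ℝ → ℝ) (hσ : ∀ i, σ i ∈ 𝒜)
      {ψ : (Fin m → ℝ) → (Fin dy → ℝ)} (hψ : IsNetwork 𝒜 m hidden dy ψ) :
      IsNetwork 𝒜 dx (m :: hidden) dy (ψ ∘ layer A b σ)

/-- The width: the largest hidden dimension, or `max dx dy` if there is no hidden layer. -/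
def width (dx : ℕ) (hidden : List ℕ) (dy : ℕ) : ℕ :=
  hidden.max?.getD (max dx dy)

/-- The minimal interior dimension: the smallest hidden dimension, or `min dx dy` if there is no
hidden layer. -/
def minInteriorDim (dx : ℕ) (hidden : List ℕ) (dy : ℕ) : ℕ :=
  hidden.min?.getD (min dx dy)

/-- The set of functions `ℝ^dx → ℝ^dy` given by feed-forward networks with activations in `𝒜`,
width `w` and minimal interior dimension `k`. -/
def FNN (𝒜 : Set (ℝ → ℝ)) (w k dx dy : ℕ) : Set ((Fin dx → ℝ) → (Fin dy → ℝ)) :=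
  {φ | ∃ hidden : List ℕ, IsNetwork 𝒜 dx hidden dy φ ∧
    width dx hidden dy = w ∧ minInteriorDim dx hidden dy = k}

/-- Autoencoders of dimension `d` with feature dimension `k` and activations in `𝒜`. -/
def autoencoders (𝒜 : Set (ℝ → ℝ)) (k d : ℕ) : Set ((Fin d → ℝ) → (Fin d → ℝ)) :=
  FNN 𝒜 d k d d

/-- The `p`-norm of a vector in `ℝ^n`. -/
noncomputable def vecNorm {n : ℕ} (p : ℝ) (v : Fin n → ℝ) : ℝ :=
  (∑ i, |v i| ^ p) ^ (1 / p)

/-- The `L^p` norm over `K` of an `ℝ^n`-valued function, with the `p`-norm on `ℝ^n` and Lebesgue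
measure on `ℝ^m`; it takes the value `∞` if `‖f‖^p` has infinite integral over `K`. -/
noncomputable def lpNormOn {m n : ℕ} (p : ℝ) (K : Set (Fin m → ℝ))
    (f : (Fin m → ℝ) → (Fin n → ℝ)) : ℝ≥0∞ :=
  eLpNorm (fun x => vecNorm p (f x)) (ENNReal.ofReal p) (volume.restrict K)

/-- `L^p(ℝ^m, ℝ^n)` with respect to Lebesgue measure, as a set of functions. -/
def LpFunctions (p : ℝ) (m n : ℕ) : Set ((Fin m → ℝ) → (Fin n → ℝ)) :=
  {g | MemLp g (ENNReal.ofReal p) volume}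

/-- `M`, a set of measurable functions that are `L^p` on compact sets, is an `L^p` universal
approximator of `G`. -/
def IsLpUniversalApproximator {m n : ℕ} (p : ℝ)
    (M G : Set ((Fin m → ℝ) → (Fin n → ℝ))) : Prop :=
  (∀ f ∈ M, Measurable f ∧ ∀ K : Set (Fin m → ℝ), IsCompact K →
    MemLp f (ENNReal.ofReal p) (volume.restrict K)) ∧
  ∀ g ∈ G, ∀ K : Set (Fin m → ℝ), IsCompact K → ∀ ε : ℝ, 0 < ε →
    ∃ f ∈ M, lpNormOn p K (fun x => f x - g x) < ENNReal.ofReal ε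

end LeakyNet

/-!
The approximating autoencoders have the form `D ∘ B ∘ E`, where `E` and `D` are networks of constant
width `d` and `B` is a linear map of rank one. Since `B` passes through a single real number, it can
be realised with a layer of any dimension `k` with `1 ≤ k < d`, so one construction serves all
feature dimensions (`comp_rankOne_mem_autoencoders`).

Two consecutive leaky layers with a sign change in between apply, exactly and on all of `ℝ^d`, a
kink of any positive slope to each coordinate, possibly the trivial one (`isNetwork_neg_kink`).
Hence networks of width `d` contain all affine maps and are closed under composition, and no error
has to be controlled outside a compact set.

*Encoder.* Composing kinks gives steep staircases (`staircase_mem_scalarNets`). Applied to every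
coordinate and followed by the linear form with weights `(m + 1)^i`, they converge pointwise to the
function that sends `x` to the number, with digits to the base `m + 1`, of the cell of a grid that
contains `x`.

*Decoder.* A kink conjugated by a linear shear is a nonlinear shear, and such shears interpolate
arbitrary displacements on finitely many values of one coordinate
(`exists_shear_interpolation`). With two of them, one along each of two coordinates, a network of
width `d ≥ 2` takes the finitely many codes on a line to points arbitrarily close to prescribed
ones (`exists_decoder`).

For a fixed grid and decoder, making the staircases steeper yields autoencoders that are uniformly
bounded on a given compact set and converge pointwise to a function close to a given continuous one
(`exists_tendsto_autoencoders`). Bounded convergence and the density of continuous functions in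
`L^p` finish the argument.
-/

namespace LeakyNet

open Filter Topology

/-! ### Leaky ReLUs and networks in general -/

lemma leakyReLU_mem {α : ℝ} (h₀ : 0 < α) (h₁ : α < 1) : leakyReLU α ∈ trueLeakyReLUs :=
  ⟨α, h₀, h₁, rfl⟩

lemma leakyReLU_eq_max {α : ℝ} (h₁ : α < 1) (x : ℝ) : leakyReLU α x = max (α * x) x := by
  unfold leakyReLU
  split_ifs with h
  · rw [max_eq_left]; nlinarith
  · rw [max_eq_right]; nlinarith

lemma IsNetwork.continuous {m n : ℕ} {hidden : List ℕ} {φ : (Fin m → ℝ) → (Fin n → ℝ)}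
    (h : IsNetwork trueLeakyReLUs m hidden n φ) : Continuous φ := by
  have layer_cont : ∀ {m n : ℕ} (A : Matrix (Fin n) (Fin m) ℝ) (b : Fin n → ℝ)
      (σ : Fin n → ℝ → ℝ), (∀ i, σ i ∈ trueLeakyReLUs) → Continuous (layer A b σ) := by
    intro m n A b σ hσ
    refine continuous_pi fun i => ?_
    obtain ⟨α, -, h₁, h⟩ := hσ i
    have : Continuous (σ i) := by
      rw [h, funext (leakyReLU_eq_max h₁)]
      fun_prop
    have h2 : Continuous fun x : Fin m → ℝ => A.mulVec x :=
      Continuous.matrix_mulVec continuous_const continuous_id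
    exact this.comp ((continuous_apply i).comp (h2.add continuous_const))
  induction h with
  | single A b σ hσ => exact layer_cont A b σ hσ
  | cons hm A b σ hσ _ ih => exact ih.comp (layer_cont A b σ hσ)

/-- Concatenating two networks turns the interface between them into a hidden layer. -/
lemma IsNetwork.comp {𝒜 : Set (ℝ → ℝ)} {l m n : ℕ} {h₁ h₂ : List ℕ}
    {φ : (Fin l → ℝ) → (Fin m → ℝ)} {ψ : (Fin m → ℝ) → (Fin n → ℝ)} (hm : 0 < m)
    (hψ : IsNetwork 𝒜 m h₂ n ψ) (hφ : IsNetwork 𝒜 l h₁ m φ) :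
    IsNetwork 𝒜 l (h₁ ++ m :: h₂) n (ψ ∘ φ) := by
  induction hφ with
  | single A b σ hσ => exact .cons hm A b σ hσ hψ
  | cons hm' A b σ hσ _ ih => exact .cons hm' A b σ hσ (ih hm hψ)

/-! ### Width-`d` networks

Two consecutive layers of the same width apply arbitrary kinks to the coordinates, and in
particular realise every affine map exactly. -/

/-- The kink at the origin with slope `1` on the right and `s` on the left; in contrast to
`leakyReLU` every positive slope is of interest, so that the kinks form a group. -/
noncomputable def kink (s x : ℝ) : ℝ := if x < 0 then s * x else x

lemma kink_kink {s t : ℝ} (ht : 0 < t) (x : ℝ) : kink s (kink t x) = kink (s * t) x := by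
  unfold kink
  split_ifs with h1 h2
  · ring
  · nlinarith
  · rfl

lemma kink_one (x : ℝ) : kink 1 x = x := by simp [kink]

lemma kink_eq (s x : ℝ) : kink s x = x + (s - 1) * min x 0 := by
  unfold kink
  split_ifs with h
  · rw [min_eq_left h.le]; ring
  · rw [min_eq_right (not_lt.mp h)]; ring

/-- Since `y ↦ -σ_β(-y)/β` is the inverse of `σ_β`, a sign change between leaky ReLUs with slopes
`α` and `β` produces the kink with slope `α / β`. -/
lemma leakyReLU_neg_leakyReLU {α β : ℝ} (hα : 0 < α) (hβ : 0 < β) (x : ℝ) :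
    leakyReLU β (-leakyReLU α (x / β)) = -kink (α / β) x := by
  have hx : x / β < 0 ↔ x < 0 := by simp [div_neg_iff, hβ, hβ.not_gt]
  unfold leakyReLU kink
  simp only [hx]
  split_ifs with h1 h2 h2
  · have := mul_neg_of_pos_of_neg hα (hx.2 h1)
    linarith
  · field_simp
  · field_simp
  · have h3 : 0 ≤ x / β := div_nonneg (not_lt.mp h1) hβ.le
    have h4 : x / β = 0 := by linarith
    have h5 : x = 0 := by simpa [hβ.ne'] using h4
    simp [h5]

lemma isNetwork_neg_kink {m n : ℕ} (hn : 0 < n) (L : (Fin m → ℝ) →ₗ[ℝ] (Fin n → ℝ))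
    (b : Fin n → ℝ) (s : Fin n → ℝ) (hs : ∀ i, 0 < s i) :
    IsNetwork trueLeakyReLUs m [n] n (fun x i => -kink (s i) (L x i + b i)) := by
  -- `β < 1` is chosen so small that the other slope `s * β` is below `1` as well
  set β : Fin n → ℝ := fun i => 1 / (2 * (1 + s i)) with hβ
  have hβ0 : ∀ i, 0 < β i := fun i => by have := hs i; simp only [hβ]; positivity
  have hβ1 : ∀ i, β i < 1 := fun i => by
    have := hs i
    simp only [hβ]
    rw [div_lt_one (by positivity)]
    linarith
  have hα1 : ∀ i, s i * β i < 1 := fun i => by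
    have := hs i
    simp only [hβ]
    rw [mul_one_div, div_lt_one (by positivity)]
    linarith
  have key := IsNetwork.cons (𝒜 := trueLeakyReLUs) hn
    (Matrix.diagonal (fun i => (β i)⁻¹) * LinearMap.toMatrix' L) (fun i => b i / β i)
    (fun i => leakyReLU (s i * β i))
    (fun i => leakyReLU_mem (mul_pos (hs i) (hβ0 i)) (hα1 i))
    (.single (-1) 0 (fun i => leakyReLU (β i)) fun i => leakyReLU_mem (hβ0 i) (hβ1 i))
  convert key using 1
  funext x i
  have h1 : ((Matrix.diagonal (fun i => (β i)⁻¹) * LinearMap.toMatrix' L).mulVec x) i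
      = L x i / β i := by
    rw [← Matrix.mulVec_mulVec, Matrix.mulVec_diagonal, LinearMap.toMatrix'_mulVec]
    ring
  have h2 := leakyReLU_neg_leakyReLU (mul_pos (hs i) (hβ0 i)) (hβ0 i) (L x i + b i)
  rw [mul_div_assoc, div_self (hβ0 i).ne', mul_one] at h2
  simp only [layer, Function.comp, Matrix.neg_mulVec, Matrix.one_mulVec, Pi.add_apply,
    Pi.neg_apply, Pi.zero_apply, add_zero, h1, ← h2, add_div]

lemma isNetwork_affine {m n : ℕ} (hn : 0 < n) (L : (Fin m → ℝ) →ₗ[ℝ] (Fin n → ℝ))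
    (b : Fin n → ℝ) : IsNetwork trueLeakyReLUs m [n] n (fun x => L x + b) := by
  have := isNetwork_neg_kink hn (-L) (-b) (fun _ => 1) (fun _ => one_pos)
  convert this using 1
  funext x i
  simp [kink_one]
  ring

/-- The maps `ℝ^d → ℝ^d` given by networks with true leaky ReLUs all of whose hidden layers have
dimension `d`. -/
def squareNets (d : ℕ) : Set ((Fin d → ℝ) → (Fin d → ℝ)) :=
  {φ | ∃ hidden : List ℕ, (∀ m ∈ hidden, m = d) ∧ IsNetwork trueLeakyReLUs d hidden d φ}

variable {d : ℕ}

lemma squareNets_comp (hd : 0 < d) {φ ψ : (Fin d → ℝ) → (Fin d → ℝ)} (hψ : ψ ∈ squareNets d)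
    (hφ : φ ∈ squareNets d) : ψ ∘ φ ∈ squareNets d := by
  obtain ⟨h₁, e₁, n₁⟩ := hφ
  obtain ⟨h₂, e₂, n₂⟩ := hψ
  refine ⟨h₁ ++ d :: h₂, fun m hm => ?_, n₂.comp hd n₁⟩
  rcases List.mem_append.1 hm with h | h
  · exact e₁ m h
  · rcases List.mem_cons.1 h with h | h
    exacts [h, e₂ m h]

lemma squareNets_affine (hd : 0 < d) (L : (Fin d → ℝ) →ₗ[ℝ] (Fin d → ℝ)) (b : Fin d → ℝ) :
    (fun x => L x + b) ∈ squareNets d :=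
  ⟨[d], by simp, isNetwork_affine hd L b⟩

lemma squareNets_kink (hd : 0 < d) (s : Fin d → ℝ) (hs : ∀ i, 0 < s i) :
    (fun (x : Fin d → ℝ) i => kink (s i) (x i)) ∈ squareNets d := by
  have h1 : (fun (x : Fin d → ℝ) i => -kink (s i) (x i)) ∈ squareNets d := by
    refine ⟨[d], by simp, ?_⟩
    simpa using isNetwork_neg_kink hd LinearMap.id 0 s hs
  convert squareNets_comp hd (squareNets_affine hd (-LinearMap.id) 0) h1 using 1
  funext x i
  simp

/-- A network of width `d` with a rank-one bottleneck of dimension `k` in the middle is an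
autoencoder with feature dimension `k`. -/
lemma comp_rankOne_mem_autoencoders {k : ℕ} (hk : 1 ≤ k) (hkd : k < d)
    {φ ψ : (Fin d → ℝ) → (Fin d → ℝ)} (hψ : ψ ∈ squareNets d) (hφ : φ ∈ squareNets d)
    (w : (Fin d → ℝ) →ₗ[ℝ] ℝ) (v : Fin d → ℝ) :
    (fun x => ψ (w (φ x) • v)) ∈ autoencoders trueLeakyReLUs k d := by
  have hd : 0 < d := hk.trans hkd.le
  obtain ⟨h₁, e₁, n₁⟩ := hφ
  obtain ⟨h₂, e₂, n₂⟩ := hψ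
  -- the number `w x` is carried by the constant vector of `ℝ^k`
  have hB : IsNetwork trueLeakyReLUs d [k, k, d] d (fun x => w x • v) := by
    have a := isNetwork_affine (n := k) hk (LinearMap.pi fun _ => w) 0
    have b := isNetwork_affine (m := k) hd ((LinearMap.proj ⟨0, hk⟩).smulRight v) 0
    convert b.comp hk a using 1
    · rfl
    · funext x
      simp
  have hn := (n₂.comp hd hB).comp hd n₁
  refine ⟨h₁ ++ d :: ([k, k, d] ++ d :: h₂), hn, ?_, ?_⟩
  · have : (h₁ ++ d :: ([k, k, d] ++ d :: h₂)).max? = some d := by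
      rw [List.max?_eq_some_iff]
      refine ⟨by simp, fun m hm => ?_⟩
      simp only [List.mem_append, List.mem_cons] at hm
      grind
    rw [width, this, Option.getD_some]
  · have : (h₁ ++ d :: ([k, k, d] ++ d :: h₂)).min? = some k := by
      rw [List.min?_eq_some_iff]
      refine ⟨by simp, fun m hm => ?_⟩
      simp only [List.mem_append, List.mem_cons] at hm
      grind
    rw [minInteriorDim, this, Option.getD_some]

/-! ### Shears and the decoder -/

/-- Conjugating a kink in the coordinate `i` by a linear shear leaves the coordinate `i` unchanged
and adds a multiple of the defect `t - kink t`, which is a multiple of `min t 0`. -/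
lemma squareNets_min_shear (hd : 0 < d) (i : Fin d) (c : ℝ) (v : Fin d → ℝ) (hv : v i = 0) :
    (fun x => x + min (x i - c) 0 • v) ∈ squareNets d := by
  classical
  have slopes : ∀ t : ℝ, 0 < t → ∀ j, 0 < (Function.update (fun _ : Fin d => (1 : ℝ)) i t) j := by
    intro t ht j
    by_cases h : j = i
    · subst h; simpa using ht
    · simp [h]
  -- `x ↦ x - c e_i + 2 (x_i - c) v`
  have a1 := squareNets_affine hd
    (LinearMap.id + (LinearMap.proj (R := ℝ) (φ := fun _ : Fin d => ℝ) i).smulRight ((2 : ℝ) • v))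
    (-(c • Pi.single i (1 : ℝ)) - (2 * c) • v)
  have a2 := squareNets_kink hd _ (slopes (1 / 2) (by norm_num))
  have a3 := squareNets_affine hd
    (LinearMap.id - (LinearMap.proj (R := ℝ) (φ := fun _ : Fin d => ℝ) i).smulRight ((2 : ℝ) • v))
    0
  have a4 := squareNets_kink hd _ (slopes 2 (by norm_num))
  have a5 := squareNets_affine hd LinearMap.id (c • Pi.single i (1 : ℝ))
  convert squareNets_comp hd a5 (squareNets_comp hd a4 (squareNets_comp hd a3
    (squareNets_comp hd a2 a1))) using 1
  funext x j
  by_cases h : j = i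
  · subst h
    have h2 : kink 2 (kink (1 / 2) (x j - c)) = x j - c := by
      rw [kink_kink (by norm_num)]; norm_num [kink_one]
    simp [hv, ← sub_eq_add_neg] at h2 ⊢
    rw [h2]; ring
  · have h2 := kink_eq (1 / 2) (x i - c)
    simp [hv, h, kink_one, ← sub_eq_add_neg] at h2 ⊢
    rw [h2]; ring

/-- Shears along the coordinate `i` interpolate prescribed displacements on a finite set of values
of that coordinate: going down from the largest node, each new node is corrected by a multiple of
`min (x_i - c) 0`, which vanishes on the nodes already treated. -/
lemma exists_shear_interpolation (hd : 0 < d) (i : Fin d) (S : Finset ℝ)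
    (V : ℝ → (Fin d → ℝ)) (hV : ∀ t, V t i = 0) :
    ∃ f : ℝ → (Fin d → ℝ), (∀ t, f t i = 0) ∧ (∀ t ∈ S, f t = V t) ∧
      (fun x => x + f (x i)) ∈ squareNets d := by
  classical
  induction S using Finset.induction_on_min with
  | empty =>
    refine ⟨0, by simp, by simp, ?_⟩
    simpa using squareNets_affine hd LinearMap.id 0
  | insert a S ha ih =>
    obtain ⟨f, hf0, hfV, hf⟩ := ih
    obtain ⟨c, hac, hc⟩ : ∃ c, a < c ∧ ∀ t ∈ S, c ≤ t := by
      rcases S.eq_empty_or_nonempty with rfl | hS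
      · exact ⟨a + 1, by linarith, by simp⟩
      · exact ⟨S.min' hS, ha _ (S.min'_mem hS), fun t ht => S.min'_le t ht⟩
    set v : Fin d → ℝ := (a - c)⁻¹ • (V a - f a) with hv
    have hvi : v i = 0 := by simp [hv, hV, hf0]
    refine ⟨fun t => f t + min (t - c) 0 • v, fun t => by simp [hf0, hvi], fun t ht => ?_, ?_⟩
    · show f t + min (t - c) 0 • v = V t
      rcases Finset.mem_insert.1 ht with rfl | ht
      · have : t - c ≠ 0 := by linarith
        rw [min_eq_left (by linarith), hv, smul_smul, mul_inv_cancel₀ this]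
        simp
      · rw [min_eq_right (by linarith [hc t ht]), hfV t ht]
        simp
    · convert squareNets_comp hd (squareNets_min_shear hd i c v hvi) hf using 1
      funext x
      simp [hf0, add_assoc]

/-- Finitely many points of the first coordinate axis can be moved to finitely many points with
distinct second coordinates: the first shear sets all coordinates but the first, the second one,
along the second coordinate, sets the first. -/
lemma exists_squareNets_interpolation {i₀ i₁ : Fin d} (hi : i₁ ≠ i₀) {S : Type*} [Fintype S]
    (c : S → ℝ) (hc : Function.Injective c) (Y : S → (Fin d → ℝ))
    (hY : Function.Injective fun s => Y s i₁) :
    ∃ D ∈ squareNets d, ∀ s, D (c s • Pi.single i₀ 1) = Y s := by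
  classical
  have hd : 0 < d := i₀.pos
  obtain ⟨f, hf0, hf, hfn⟩ := exists_shear_interpolation hd i₀ (Finset.univ.image c)
    (fun t => Function.extend c (fun s => Function.update (Y s) i₀ 0) 0 t) (by
      intro t
      by_cases h : ∃ s, c s = t
      · obtain ⟨s, rfl⟩ := h
        simp [hc.extend_apply]
      · simp [Function.extend_apply' _ _ _ h])
  obtain ⟨g, hg0, hg, hgn⟩ := exists_shear_interpolation hd i₁
    (Finset.univ.image fun s => Y s i₁)
    (fun t => Function.extend (fun s => Y s i₁)
      (fun s => (Y s i₀ - c s) • Pi.single i₀ (1 : ℝ)) 0 t) (by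
      intro t
      by_cases h : ∃ s, Y s i₁ = t
      · obtain ⟨s, rfl⟩ := h
        rw [hY.extend_apply]
        simp [hi]
      · rw [Function.extend_apply' _ _ _ h]
        simp)
  refine ⟨_, squareNets_comp hd hgn hfn, fun s => ?_⟩
  have h1 : f (c s) = Function.update (Y s) i₀ 0 := by
    rw [hf _ (by simp), hc.extend_apply]
  have h2 : g (Y s i₁) = (Y s i₀ - c s) • Pi.single i₀ (1 : ℝ) := by
    rw [hg _ (Finset.mem_image_of_mem _ (Finset.mem_univ s)), hY.extend_apply]
  funext j
  by_cases hj : j = i₀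
  · subst hj; simp [h1, h2, hi]
  · simp [h1, h2, hi, hj]

/-- The decoder: distinct codes on the first axis are mapped into arbitrarily small neighbourhoods
of arbitrary points. A small multiple of the code is added to the second coordinate of the targets
to make these coordinates distinct. -/
lemma exists_decoder (hd : 2 ≤ d) {S : Type*} [Fintype S] (c : S → ℝ) (hc : Function.Injective c)
    (Y : S → (Fin d → ℝ)) {ε : ℝ} (hε : 0 < ε) :
    ∃ D ∈ squareNets d, ∃ v : Fin d → ℝ, ∀ s, ‖D (c s • v) - Y s‖ ≤ ε := by
  classical
  set i₀ : Fin d := ⟨0, by omega⟩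
  set i₁ : Fin d := ⟨1, by omega⟩
  have hi : i₁ ≠ i₀ := by simp [i₀, i₁]
  obtain ⟨C, hC⟩ : ∃ C, ∀ s, |c s| ≤ C := by
    obtain ⟨C, hC⟩ := (Set.finite_range fun s => |c s|).bddAbove
    exact ⟨C, fun s => hC ⟨s, rfl⟩⟩
  have hr : 0 < ε / (|C| + 1) := by positivity
  -- the finitely many `η` for which two of the second coordinates collide
  obtain ⟨η, ⟨hη0, hη1⟩, hη⟩ := (Set.Ioo_infinite hr).exists_notMem_finset
    (Finset.univ.image fun q : S × S => -(Y q.1 i₁ - Y q.2 i₁) / (c q.1 - c q.2))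
  obtain ⟨D, hD, h⟩ := exists_squareNets_interpolation hi c hc
    (fun s => Y s + (η * c s) • Pi.single i₁ 1) (by
      intro s t hst
      by_contra hne
      refine hη (Finset.mem_image.2 ⟨(s, t), Finset.mem_univ _, ?_⟩)
      have : c s - c t ≠ 0 := sub_ne_zero.2 (hc.ne hne)
      simp at hst
      field_simp
      linarith)
  refine ⟨D, hD, Pi.single i₀ 1, fun s => ?_⟩
  rw [h s, add_sub_cancel_left, norm_smul, Pi.norm_single, norm_one, mul_one, Real.norm_eq_abs,
    abs_mul, abs_of_pos hη0]
  calc η * |c s| ≤ ε / (|C| + 1) * (|C| + 1) := by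
        have := (hC s).trans (le_abs_self C)
        gcongr
        linarith
    _ = ε := by field_simp

/-! ### Staircases and the encoder -/

/-- The functions `ℝ → ℝ` whose coordinatewise application to `ℝ^d` is a width-`d` network. -/
def scalarNets (d : ℕ) : Set (ℝ → ℝ) :=
  {f | (fun (x : Fin d → ℝ) i => f (x i)) ∈ squareNets d}

lemma scalarNets_comp (hd : 0 < d) {f g : ℝ → ℝ} (hg : g ∈ scalarNets d)
    (hf : f ∈ scalarNets d) : g ∘ f ∈ scalarNets d :=
  squareNets_comp hd hg hf

lemma scalarNets_affine (hd : 0 < d) (a b : ℝ) : (fun x => a * x + b) ∈ scalarNets d := by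
  show (fun (x : Fin d → ℝ) i => a * x i + b) ∈ squareNets d
  exact squareNets_affine hd (a • LinearMap.id) fun _ => b

/-- If `f` is increasing, and affine to the right of `b`, then its slope there can be changed to
any other positive slope, by composing `f` with a kink at `f b`. -/
lemma scalarNets_add_hinge (hd : 0 < d) {f : ℝ → ℝ} (hf : f ∈ scalarNets d) (hmono : Monotone f)
    {a b σ : ℝ} (hσ : 0 < σ) (ha : -σ < a) (htail : ∀ x, b ≤ x → f x = f b + σ * (x - b)) :
    (fun x => f x + a * max (x - b) 0) ∈ scalarNets d := by
  have hs : 0 < (σ + a) / σ := div_pos (by linarith) hσ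
  have hk : (fun x => kink ((σ + a) / σ) x) ∈ scalarNets d :=
    squareNets_kink hd (fun _ => (σ + a) / σ) fun _ => hs
  convert scalarNets_comp hd (scalarNets_affine hd (-1) (f b)) (scalarNets_comp hd hk
    (scalarNets_comp hd (scalarNets_affine hd (-1) (f b)) hf)) using 1
  funext x
  simp only [Function.comp, kink_eq]
  rcases le_total b x with h | h
  · rw [max_eq_left (by linarith), htail x h, min_eq_left (by nlinarith)]
    field_simp
    ring
  · have := hmono h
    rw [max_eq_right (by linarith), min_eq_right (by linarith)]
    ring

/-- The continuous function that is `0` on `(-∞, 0]`, `1` on `[δ, ∞)` and affine in between. -/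
noncomputable def ramp (δ x : ℝ) : ℝ := (max x 0 - max (x - δ) 0) / δ

lemma ramp_of_nonpos {δ x : ℝ} (hδ : 0 < δ) (hx : x ≤ 0) : ramp δ x = 0 := by
  rw [ramp, max_eq_right hx, max_eq_right (by linarith)]
  simp

lemma ramp_of_le {δ x : ℝ} (hδ : 0 < δ) (hx : δ ≤ x) : ramp δ x = 1 := by
  rw [ramp, max_eq_left (by linarith), max_eq_left (by linarith), sub_sub_cancel, div_self hδ.ne']

lemma ramp_monotone {δ : ℝ} (hδ : 0 < δ) : Monotone (ramp δ) := by
  intro x y hxy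
  unfold ramp
  gcongr ?_ / δ
  grind

lemma ramp_mem_Icc {δ : ℝ} (hδ : 0 < δ) (x : ℝ) : 0 ≤ ramp δ x ∧ ramp δ x ≤ 1 := by
  unfold ramp
  rw [le_div_iff₀ hδ, div_le_iff₀ hδ]
  grind

/-- A strictly increasing staircase with `m` steps, at `1, …, m`, of height `1` and width `δ`, and
with slope `δ` between the steps. -/
noncomputable def staircase (δ : ℝ) (m : ℕ) (x : ℝ) : ℝ :=
  δ * x + ∑ j ∈ Finset.range m, ramp δ (x - (j + 1))

/-- The number of `j = 1, …, m` with `j < x`, which is the limit of the staircases. -/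
noncomputable def stepIndex (m : ℕ) (x : ℝ) : ℕ :=
  ∑ j ∈ Finset.range m, if (j : ℝ) + 1 < x then 1 else 0

lemma staircase_monotone {δ : ℝ} (hδ : 0 < δ) (m : ℕ) : Monotone (staircase δ m) := by
  intro x y hxy
  unfold staircase
  gcongr with j _
  exact ramp_monotone hδ (by linarith)

lemma staircase_of_le {δ x : ℝ} {m : ℕ} (hδ : 0 < δ) (hx : m + δ ≤ x) :
    staircase δ m x = δ * x + m := by
  unfold staircase
  rw [Finset.sum_congr rfl fun j hj => ramp_of_le hδ ?_]
  · simp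
  · have : (j : ℝ) + 1 ≤ m := by exact_mod_cast Finset.mem_range.1 hj
    linarith

lemma abs_staircase_le {δ : ℝ} (hδ : 0 < δ) (hδ1 : δ ≤ 1) (m : ℕ) (x : ℝ) :
    |staircase δ m x| ≤ |x| + m := by
  have h0 : 0 ≤ ∑ j ∈ Finset.range m, ramp δ (x - (j + 1)) :=
    Finset.sum_nonneg fun j _ => (ramp_mem_Icc hδ _).1
  have h1 : ∑ j ∈ Finset.range m, ramp δ (x - (j + 1)) ≤ m := by
    simpa using Finset.sum_le_card_nsmul (Finset.range m) (fun j => ramp δ (x - (j + 1))) 1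
      fun j _ => (ramp_mem_Icc hδ _).2
  calc |staircase δ m x| ≤ |δ * x| + |∑ j ∈ Finset.range m, ramp δ (x - (j + 1))| :=
        abs_add_le _ _
    _ ≤ |x| + m := by
        rw [abs_of_nonneg h0, abs_mul, abs_of_pos hδ]
        nlinarith [abs_nonneg x]

/-- A new step is added to the right of a staircase by two kinks, one at each end of the step. -/
lemma staircase_mem_scalarNets (hd : 0 < d) {δ : ℝ} (hδ : 0 < δ) (hδ1 : δ ≤ 1) (m : ℕ) :
    staircase δ m ∈ scalarNets d := by
  induction m with
  | zero =>
    convert scalarNets_affine hd δ 0 using 1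
    funext x
    simp [staircase]
  | succ m ih =>
    have hd' : 0 < 1 / δ := by positivity
    obtain ⟨b, hb⟩ : ∃ b : ℝ, b = m + 1 := ⟨_, rfl⟩
    have tail : ∀ x, b ≤ x → staircase δ m x = staircase δ m b + δ * (x - b) := by
      intro x hx
      rw [staircase_of_le hδ (by linarith), staircase_of_le hδ (by linarith)]
      ring
    have h1 := scalarNets_add_hinge hd ih (staircase_monotone hδ m) (a := 1 / δ) hδ
      (by linarith) tail
    have h2 := scalarNets_add_hinge hd h1 (a := -(1 / δ)) (b := b + δ) (σ := δ + 1 / δ)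
      ((staircase_monotone hδ m).add fun x y hxy => by gcongr)
      (by positivity) (by linarith) (by
        intro x hx
        rw [tail x (by linarith), tail (b + δ) (by linarith), max_eq_left (by linarith),
          max_eq_left (by linarith)]
        ring)
    convert h2 using 1
    funext x
    rw [staircase, Finset.sum_range_succ, ← add_assoc, ← staircase, ramp, ← hb, ← sub_sub x b δ]
    ring

lemma tendsto_staircase {δ : ℕ → ℝ} (hδ : ∀ n, 0 < δ n) (hlim : Tendsto δ atTop (𝓝 0)) (m : ℕ)
    (x : ℝ) : Tendsto (fun n => staircase (δ n) m x) atTop (𝓝 (stepIndex m x)) := by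
  have h : ∀ j ∈ Finset.range m, Tendsto (fun n => ramp (δ n) (x - (j + 1))) atTop
      (𝓝 (if (j : ℝ) + 1 < x then 1 else 0)) := by
    intro j _
    split_ifs with hj
    · refine tendsto_const_nhds.congr' ?_
      filter_upwards [hlim.eventually_lt_const (sub_pos.2 hj)] with n hn
      rw [ramp_of_le (hδ n) hn.le]
    · refine tendsto_const_nhds.congr fun n => ?_
      rw [ramp_of_nonpos (hδ n) (by linarith)]
  have := (hlim.mul_const x).add (tendsto_finsetSum _ h)
  simpa [stepIndex, staircase] using this

lemma stepIndex_le (m : ℕ) (x : ℝ) : stepIndex m x ≤ m := by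
  unfold stepIndex
  refine (Finset.sum_le_card_nsmul _ _ 1 fun j _ => ?_).trans (by simp)
  split_ifs <;> simp

lemma stepIndex_succ (m : ℕ) (x : ℝ) :
    stepIndex (m + 1) x = stepIndex m x + if (m : ℝ) + 1 < x then 1 else 0 :=
  Finset.sum_range_succ _ _

lemma stepIndex_of_lt {m : ℕ} {x : ℝ} (h : m < x) : stepIndex m x = m := by
  unfold stepIndex
  rw [Finset.sum_congr rfl fun j hj => if_pos ?_]
  · simp
  · have : (j : ℝ) + 1 ≤ m := by exact_mod_cast Finset.mem_range.1 hj
    linarith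

lemma abs_stepIndex_sub_le {m : ℕ} {x : ℝ} (h0 : 0 ≤ x) (h1 : x ≤ m + 1) :
    |stepIndex m x - x| ≤ 1 := by
  induction m with
  | zero =>
    simp [stepIndex, abs_of_nonneg h0]
    simpa using h1
  | succ m ih =>
    rw [stepIndex_succ]
    push_cast at h1
    split_ifs with h
    · rw [stepIndex_of_lt (by linarith), abs_le]
      push_cast
      constructor <;> linarith
    · simpa using ih (not_lt.1 h)

/-! ### Approximation in `L^p` -/

/-- On a compact set a continuous map is, up to an arbitrarily small uniform error, a bounded
pointwise limit of autoencoders: the limit reads off the cell of a fine grid that contains `x` and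
returns approximately the value at a corner of the cell. -/
lemma exists_tendsto_autoencoders (hd : 2 ≤ d) {k : ℕ} (hk : 1 ≤ k) (hkd : k < d)
    {G : (Fin d → ℝ) → (Fin d → ℝ)} (hG : Continuous G) {K : Set (Fin d → ℝ)} (hK : IsCompact K)
    {δ : ℝ} (hδ : 0 < δ) :
    ∃ (f : ℕ → (Fin d → ℝ) → (Fin d → ℝ)) (H : (Fin d → ℝ) → (Fin d → ℝ)) (C : ℝ),
      (∀ n, f n ∈ autoencoders trueLeakyReLUs k d) ∧ (∀ n, ∀ x ∈ K, ‖f n x‖ ≤ C) ∧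
      (∀ x ∈ K, Tendsto (fun n => f n x) atTop (𝓝 (H x))) ∧ ∀ x ∈ K, ‖H x - G x‖ ≤ δ := by
  have hd0 : 0 < d := by omega
  obtain ⟨R, hR0, hR⟩ : ∃ R : ℝ, 0 < R ∧ ∀ x ∈ K, ‖x‖ ≤ R := hK.isBounded.exists_pos_norm_le
  obtain ⟨η, hη0, hη⟩ := Metric.uniformContinuousOn_iff.1
    ((isCompact_closedBall (0 : Fin d → ℝ) R).uniformContinuousOn_of_continuous hG.continuousOn)
    (δ / 2) (by positivity)
  -- the grid has `m` cells of side `h = 2 R / m < η` in each direction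
  obtain ⟨m, hm⟩ := exists_nat_gt (2 * R / η)
  have hm0 : (0 : ℝ) < m := lt_trans (by positivity) hm
  set h : ℝ := 2 * R / m with hh
  have hh0 : 0 < h := by positivity
  have hhη : h < η := by
    rw [hh, div_lt_iff₀ hm0]
    rw [div_lt_iff₀ hη0] at hm
    linarith
  have hmh : m * h = 2 * R := by rw [hh]; field_simp
  -- cells are numbered by their digits to the base `m + 1`
  set code : (Fin d → Fin (m + 1)) → ℝ := fun s => ((finFunctionFinEquiv s : ℕ) : ℝ) with hcode
  have hinj : Function.Injective code := fun s t hst =>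
    finFunctionFinEquiv.injective (Fin.ext (Nat.cast_injective (R := ℝ) hst))
  obtain ⟨D, hD, v, hDv⟩ := exists_decoder hd code hinj
    (fun s => G fun i => -R + h * ((s i : ℕ) : ℝ)) (half_pos hδ)
  set w : (Fin d → ℝ) →ₗ[ℝ] ℝ :=
    ∑ i : Fin d, ((m + 1 : ℝ) ^ (i : ℕ)) • LinearMap.proj i with hw
  have hwx : ∀ x, w x = ∑ i : Fin d, (m + 1 : ℝ) ^ (i : ℕ) * x i := by
    intro x
    simp [hw]
  set u : (Fin d → ℝ) → (Fin d → ℝ) := fun x i => 1 / h * x i + R / h with hu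
  have hu01 : ∀ x ∈ K, ∀ i, 0 ≤ u x i ∧ u x i ≤ m := by
    intro x hx i
    have := abs_le.1 ((norm_le_pi_norm x i).trans (hR x hx))
    have e : u x i = (x i + R) / h := by simp only [hu]; ring
    rw [e, le_div_iff₀ hh0, div_le_iff₀ hh0]
    constructor <;> linarith
  set γ : ℕ → ℝ := fun n => 1 / ((n : ℝ) + 1) with hγ
  have hγ0 : ∀ n, 0 < γ n := fun n => by positivity
  have hγ1 : ∀ n, γ n ≤ 1 := fun n => by
    simp only [hγ]
    rw [div_le_one (by positivity)]
    linarith [(Nat.cast_nonneg n : (0 : ℝ) ≤ n)]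
  set E : ℕ → (Fin d → ℝ) → (Fin d → ℝ) := fun n x i => staircase (γ n) m (u x i) with hE
  have hEmem : ∀ n, E n ∈ squareNets d := fun n =>
    scalarNets_comp hd0 (staircase_mem_scalarNets hd0 (hγ0 n) (hγ1 n) m)
      (scalarNets_affine hd0 (1 / h) (R / h))
  have hDcont : Continuous D := by
    obtain ⟨_, _, hn⟩ := hD
    exact hn.continuous
  set s : (Fin d → ℝ) → (Fin d → Fin (m + 1)) := fun x i =>
    ⟨stepIndex m (u x i), Nat.lt_succ_of_le (stepIndex_le _ _)⟩ with hs
  have hcodes : ∀ x, code (s x) = w fun i => (stepIndex m (u x i) : ℝ) := by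
    intro x
    rw [hwx]
    simp only [hcode, finFunctionFinEquiv_apply, hs]
    push_cast
    exact Finset.sum_congr rfl fun i _ => mul_comm _ _
  set B : ℝ := ∑ i : Fin d, (m + 1 : ℝ) ^ (i : ℕ) * (m + m) with hB
  have hwB : ∀ n, ∀ x ∈ K, w (E n x) ∈ Set.Icc (-B) B := by
    intro n x hx
    rw [Set.mem_Icc, ← abs_le, hwx]
    refine (Finset.abs_sum_le_sum_abs _ _).trans (Finset.sum_le_sum fun i _ => ?_)
    rw [abs_mul, abs_of_pos (by positivity)]
    refine mul_le_mul_of_nonneg_left ?_ (by positivity)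
    refine (abs_staircase_le (hγ0 n) (hγ1 n) m _).trans ?_
    rw [abs_of_nonneg (hu01 x hx i).1]
    linarith [(hu01 x hx i).2]
  obtain ⟨C, hC⟩ := (isCompact_Icc (a := -B) (b := B)).exists_bound_of_continuousOn
    (f := fun t : ℝ => D (t • v)) (by fun_prop)
  refine ⟨fun n x => D (w (E n x) • v), fun x => D (code (s x) • v), C, fun n => ?_, fun n x hx =>
    hC _ (hwB n x hx), fun x _ => ?_, fun x hx => ?_⟩
  · exact comp_rankOne_mem_autoencoders hk hkd hD (hEmem n) w v
  · have h1 : Tendsto (fun n => E n x) atTop (𝓝 fun i => (stepIndex m (u x i) : ℝ)) :=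
      tendsto_pi_nhds.2 fun i => tendsto_staircase hγ0 tendsto_one_div_add_atTop_nhds_zero_nat m _
    have h2 : Continuous fun y => D (w y • v) :=
      hDcont.comp ((LinearMap.continuous_of_finiteDimensional w).smul continuous_const)
    have h3 := (h2.tendsto _).comp h1
    rw [← hcodes] at h3
    exact h3
  · set y : Fin d → ℝ := fun i => -R + h * ((s x i : ℕ) : ℝ) with hy
    have hyR : y ∈ Metric.closedBall (0 : Fin d → ℝ) R := by
      rw [mem_closedBall_zero_iff, pi_norm_le_iff_of_nonneg hR0.le]
      intro i
      have h1 : ((s x i : ℕ) : ℝ) ≤ m := by exact_mod_cast stepIndex_le m (u x i)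
      have h2 : (0 : ℝ) ≤ ((s x i : ℕ) : ℝ) := Nat.cast_nonneg _
      rw [Real.norm_eq_abs, abs_le]
      simp only [hy]
      constructor <;> nlinarith
    have hxy : dist y x < η := by
      refine ((dist_pi_le_iff hh0.le).2 fun i => ?_).trans_lt hhη
      have h1 := abs_stepIndex_sub_le (hu01 x hx i).1 ((hu01 x hx i).2.trans (by linarith))
      have e : y i - x i = h * ((stepIndex m (u x i) : ℝ) - u x i) := by
        simp only [hy, hs, hu]
        field_simp
        ring
      rw [Real.dist_eq, e, abs_mul, abs_of_pos hh0]
      nlinarith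
    have h1 := hη y hyR x (mem_closedBall_zero_iff.2 (hR x hx)) hxy
    rw [dist_eq_norm] at h1
    calc ‖D (code (s x) • v) - G x‖ ≤ ‖D (code (s x) • v) - G y‖ + ‖G y - G x‖ :=
          norm_sub_le_norm_sub_add_norm_sub _ _ _
      _ ≤ δ / 2 + δ / 2 := add_le_add (hDv (s x)) h1.le
      _ = δ := add_halves δ

lemma continuous_of_mem_autoencoders {k : ℕ} {f : (Fin d → ℝ) → (Fin d → ℝ)}
    (hf : f ∈ autoencoders trueLeakyReLUs k d) : Continuous f := by
  obtain ⟨_, hn, -⟩ := hf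
  exact hn.continuous

lemma memLp_restrict_of_continuous {m n : ℕ} {f : (Fin m → ℝ) → (Fin n → ℝ)} (hf : Continuous f)
    {K : Set (Fin m → ℝ)} (hK : IsCompact K) (q : ℝ≥0∞) : MemLp f q (volume.restrict K) := by
  have : IsFiniteMeasure (volume.restrict K) := ⟨by simpa using hK.measure_lt_top⟩
  obtain ⟨C, hC⟩ := hK.exists_bound_of_continuousOn hf.continuousOn
  exact MemLp.of_bound hf.aestronglyMeasurable C
    ((ae_restrict_iff' hK.measurableSet).2 (.of_forall hC))

/-- Bounded convergence in `L^q`. -/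
lemma tendsto_eLpNorm_sub_of_bounded {α F : Type*} [MeasurableSpace α] [NormedAddCommGroup F]
    {μ : Measure α} [IsFiniteMeasure μ] {q : ℝ≥0∞} (hq : 1 ≤ q) (hq' : q ≠ ∞)
    {f : ℕ → α → F} {H : α → F} (hf : ∀ n, AEStronglyMeasurable (f n) μ) {C : ℝ}
    (hC : ∀ n, ∀ᵐ x ∂μ, ‖f n x‖ ≤ C)
    (hlim : ∀ᵐ x ∂μ, Tendsto (fun n => f n x) atTop (𝓝 (H x))) :
    Tendsto (fun n => eLpNorm (f n - H) q μ) atTop (𝓝 0) := by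
  have hHm : AEStronglyMeasurable H μ := aestronglyMeasurable_of_tendsto_ae atTop hf hlim
  have hHC : ∀ᵐ x ∂μ, ‖H x‖ ≤ C := by
    filter_upwards [hlim, ae_all_iff.2 hC] with x hx hx'
    exact le_of_tendsto' hx.norm hx'
  refine tendsto_Lp_finite_of_tendsto_ae hq hq' hf (MemLp.of_bound hHm C hHC) ?_ hlim
  refine unifIntegrable_of hq hq' hf fun ε hε => ⟨(C + 1).toNNReal, fun n => ?_⟩
  have : {x | (C + 1).toNNReal ≤ ‖f n x‖₊}.indicator (f n) =ᵐ[μ] 0 := by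
    filter_upwards [hC n] with x hx
    refine Set.indicator_of_notMem (fun hmem => ?_) _
    have h2 : ((C + 1).toNNReal : ℝ) ≤ ‖f n x‖ := hmem
    have := (Real.le_coe_toNNReal (C + 1)).trans h2
    linarith
  rw [eLpNorm_congr_ae this]
  simp

lemma exists_autoencoder_near_continuous (hd : 2 ≤ d) {k : ℕ} (hk : 1 ≤ k) (hkd : k < d)
    {G : (Fin d → ℝ) → (Fin d → ℝ)} (hG : Continuous G) {K : Set (Fin d → ℝ)} (hK : IsCompact K)
    {q : ℝ≥0∞} (hq : 1 ≤ q) (hq' : q ≠ ∞) {ε : ℝ≥0∞} (hε : ε ≠ 0) :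
    ∃ f ∈ autoencoders trueLeakyReLUs k d, eLpNorm (f - G) q (volume.restrict K) < ε := by
  have : IsFiniteMeasure (volume.restrict K) := ⟨by simpa using hK.measure_lt_top⟩
  have hε2 : ε / 2 ≠ 0 := (ENNReal.half_pos hε).ne'
  have hμ : (volume.restrict K) Set.univ ^ q.toReal⁻¹ ≠ ∞ :=
    ENNReal.rpow_ne_top_of_nonneg (by positivity) (measure_ne_top _ _)
  obtain ⟨δ, hδ0, hδ⟩ := ENNReal.exists_nnreal_pos_mul_lt hμ hε2
  obtain ⟨f, H, C, hf, hC, hlim, hH⟩ := exists_tendsto_autoencoders hd hk hkd hG hK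
    (δ := δ) (by exact_mod_cast hδ0)
  have ae : ∀ {P : (Fin d → ℝ) → Prop}, (∀ x ∈ K, P x) → ∀ᵐ x ∂(volume.restrict K), P x :=
    fun h => (ae_restrict_iff' hK.measurableSet).2 (.of_forall h)
  have hfm : ∀ n, AEStronglyMeasurable (f n) (volume.restrict K) := fun n =>
    (continuous_of_mem_autoencoders (hf n)).aestronglyMeasurable
  have hHm : AEStronglyMeasurable H (volume.restrict K) :=
    aestronglyMeasurable_of_tendsto_ae atTop hfm (ae hlim)
  have h0 := tendsto_eLpNorm_sub_of_bounded hq hq' hfm (fun n => ae (hC n)) (ae hlim)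
  obtain ⟨n, hn⟩ := (h0.eventually_lt_const (pos_iff_ne_zero.2 hε2)).exists
  have h2 : eLpNorm (H - G) q (volume.restrict K) < ε / 2 := by
    refine (eLpNorm_le_of_ae_bound (C := δ) (ae hH)).trans_lt ?_
    rwa [ENNReal.ofReal_coe_nnreal, mul_comm]
  refine ⟨f n, hf n, ?_⟩
  calc eLpNorm (f n - G) q (volume.restrict K)
      = eLpNorm ((f n - H) + (H - G)) q (volume.restrict K) := by rw [sub_add_sub_cancel]
    _ ≤ _ := eLpNorm_add_le ((hfm n).sub hHm) (hHm.sub hG.aestronglyMeasurable) hq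
    _ < ε / 2 + ε / 2 := ENNReal.add_lt_add hn h2
    _ = ε := ENNReal.add_halves ε

lemma vecNorm_le {n : ℕ} {p : ℝ} (hp : 1 ≤ p) (v : Fin n → ℝ) :
    ‖vecNorm p v‖ ≤ (n : ℝ) ^ (1 / p) * ‖v‖ := by
  have hp0 : 0 < p := by linarith
  have hsum : 0 ≤ ∑ i, |v i| ^ p := Finset.sum_nonneg fun i _ => by positivity
  rw [vecNorm, Real.norm_of_nonneg (by positivity)]
  calc (∑ i, |v i| ^ p) ^ (1 / p) ≤ ((n : ℝ) * ‖v‖ ^ p) ^ (1 / p) := by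
        refine Real.rpow_le_rpow hsum ?_ (by positivity)
        have : ∀ i ∈ Finset.univ, |v i| ^ p ≤ ‖v‖ ^ p := fun i _ =>
          Real.rpow_le_rpow (abs_nonneg _) (norm_le_pi_norm v i) hp0.le
        simpa using Finset.sum_le_card_nsmul _ _ _ this
    _ = (n : ℝ) ^ (1 / p) * ‖v‖ := by
        rw [Real.mul_rpow (by positivity) (by positivity), ← Real.rpow_mul (norm_nonneg v),
          mul_one_div_cancel hp0.ne', Real.rpow_one]

theorem autoencoders_isLpUniversalApproximator (hd : 2 ≤ d) {p : ℝ} (hp : 1 ≤ p) {k : ℕ}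
    (hk : 1 ≤ k) (hkd : k < d) :
    IsLpUniversalApproximator p (autoencoders trueLeakyReLUs k d) (LpFunctions p d d) := by
  refine ⟨fun f hf => ?_, fun g hg K hK ε hε => ?_⟩
  · have hc := continuous_of_mem_autoencoders hf
    exact ⟨hc.measurable, fun K hK => memLp_restrict_of_continuous hc hK _⟩
  have hq : 1 ≤ ENNReal.ofReal p := by simpa using ENNReal.ofReal_le_ofReal hp
  have hg' : MemLp g (ENNReal.ofReal p) volume := hg
  -- it suffices to be within `η` for the sup norm on `ℝ^d`
  obtain ⟨η, hη0, hη⟩ := ENNReal.exists_nnreal_pos_mul_lt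
    (ENNReal.ofReal_ne_top (r := (d : ℝ) ^ (1 / p))) (ENNReal.ofReal_pos.2 hε).ne'
  have hη2 : (η : ℝ≥0∞) / 2 ≠ 0 := (ENNReal.half_pos (by exact_mod_cast hη0.ne')).ne'
  obtain ⟨G, -, hgG, hG, -⟩ :=
    hg'.exists_hasCompactSupport_eLpNorm_sub_le ENNReal.ofReal_ne_top hη2
  obtain ⟨f, hf, hfG⟩ := exists_autoencoder_near_continuous hd hk hkd hG hK hq
    ENNReal.ofReal_ne_top hη2
  refine ⟨f, hf, ?_⟩
  have hfg : eLpNorm (fun x => f x - g x) (ENNReal.ofReal p) (volume.restrict K) ≤ η := by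
    have hGg : eLpNorm (G - g) (ENNReal.ofReal p) (volume.restrict K) ≤ η / 2 := by
      rw [eLpNorm_sub_comm]
      exact (eLpNorm_mono_measure _ Measure.restrict_le_self).trans hgG
    calc eLpNorm (fun x => f x - g x) (ENNReal.ofReal p) (volume.restrict K)
        = eLpNorm ((f - G) + (G - g)) (ENNReal.ofReal p) (volume.restrict K) := by
          rw [sub_add_sub_cancel]; rfl
      _ ≤ _ := eLpNorm_add_le
          (((continuous_of_mem_autoencoders hf).sub hG).aestronglyMeasurable)
          (hG.aestronglyMeasurable.sub hg'.1.restrict) hq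
      _ ≤ η / 2 + η / 2 := add_le_add hfG.le hGg
      _ = η := ENNReal.add_halves _
  calc lpNormOn p K (fun x => f x - g x)
      ≤ ENNReal.ofReal ((d : ℝ) ^ (1 / p)) *
          eLpNorm (fun x => f x - g x) (ENNReal.ofReal p) (volume.restrict K) :=
        eLpNorm_le_mul_eLpNorm_of_ae_le_mul (.of_forall fun x => vecNorm_le hp _) _
    _ ≤ ENNReal.ofReal ((d : ℝ) ^ (1 / p)) * η := by gcongr
    _ = η * ENNReal.ofReal ((d : ℝ) ^ (1 / p)) := mul_comm _ _
    _ < ENNReal.ofReal ε := hη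

end LeakyNet

theorem mainTheorem2 (d : ℕ) (hd : 2 ≤ d) (p : ℝ) (hp : 1 ≤ p) :
    LeakyNet.IsLpUniversalApproximator p
      (LeakyNet.autoencoders LeakyNet.trueLeakyReLUs 1 d) (LeakyNet.LpFunctions p d d) ∧
    ∀ k : ℕ, 1 ≤ k → k < d →
      LeakyNet.IsLpUniversalApproximator p
        (LeakyNet.autoencoders LeakyNet.trueLeakyReLUs k d) (LeakyNet.LpFunctions p d d) := by
  exact ⟨LeakyNet.autoencoders_isLpUniversalApproximator hd hp le_rfl (by omega),
    fun _ hk hkd => LeakyNet.autoencoders_isLpUniversalApproximator hd hp hk hkd⟩
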